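/- Let $0<q<1$. For $|p|<1$ and $x\in\mathbb{C}\setminus\{0\}$ put $$\theta_p(x)=(x;p)_\infty\,(p x^{-1};p)_\infty,\qquad (a;p)_\infty=\prod_{k=0}^\infty(1-ap^k).$$ For a sequence $\psi=(\psi_n)_{n\in\mathbb{Z}}$ of complex numbers let $(\mathcal{A}\psi)_n=q^{-n+1}\psi_{n-1}+q^{-n}\psi_{n+1}$, $n\in\mathbb{Z}$, and let $D=\{\psi\in\ell^2(\mathbb{Z})\mid \mathcal{A}\psi\in\ell^2(\mathbb{Z})\}$. For $t\in\mathbb{R}\cup\{\infty\}$ let $A_t$ be the operator on $\ell^2(\mathbb{Z})$ acting as $A_t\psi=\mathcal{A}\psi$ on the domain $$\operatorname{Dom}A_t=\Big\{\psi\in D\;\Big|\;\lim_{n\to\infty}q^{-n}(\psi_{2n+1}+t\psi_{2n})=0\ \text{ and }\ \lim_{n\to\infty}q^{-n}(q\psi_{2n-1}-t\psi_{2n})=0\Big\}$$ if $t\in\mathbb{R}$, and $$\operatorname{Dom}A_\infty=\Big\{\psi\in D\;\Big|\;\lim_{n\to\infty}q^{-n}\psi_{2n}=0\Big\}$$ if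 $t=\infty$. Then: (i) for every $t\in\mathbb{R}$, the set of eigenvalues of $A_t$ in $\mathbb{C}$ is exactly the set of roots $x\in\mathbb{C}\setminus\{0\}$ of $$x\,\theta_{q^4}(q^2x^2)+t\,\theta_{q^4}(x^2)=0;$$ (ii) the set of eigenvalues of $A_\infty$ in $\mathbb{C}$ is exactly the set of roots $x\in\mathbb{C}\setminus\{0\}$ of $\theta_{q^4}(x^2)=0$; (iii) for every $t\in\mathbb{R}\cup\{\infty\}$, all eigenvalues of $A_t$ are real and simple, i.e. each eigenspace is one-dimensional. -/

import Mathlib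

open Filter Topology
open scoped lp

noncomputable section

/-- The infinite `q`-Pochhammer symbol `(a; q)_∞ = ∏_{k ≥ 0} (1 - a q^k)`. -/
def qPochInf (a q : ℂ) : ℂ := ∏' k : ℕ, (1 - a * q ^ k)

/-- The theta function `θ_q(x) = (x; q)_∞ (q x⁻¹; q)_∞`, meaningful for `x ≠ 0`. -/
def qTheta (q x : ℂ) : ℂ := qPochInf x q * qPochInf (q * x⁻¹) q

/-- The difference expression `(Aψ)_n = q^{-n+1} ψ_{n-1} + q^{-n} ψ_{n+1}` on arbitrary
doubly infinite sequences. -/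
def jacobiExpr (q : ℝ) : (ℤ → ℂ) →ₗ[ℂ] (ℤ → ℂ) where
  toFun ψ n := (q : ℂ) ^ (-n + 1) * ψ (n - 1) + (q : ℂ) ^ (-n) * ψ (n + 1)
  map_add' ψ χ := by
    funext n
    simp only [Pi.add_apply]
    ring
  map_smul' c ψ := by
    funext n
    simp only [Pi.smul_apply, smul_eq_mul, RingHom.id_apply]
    ring

/-- The maximal operator of the difference expression, with domain
`D = {ψ ∈ ℓ²(ℤ) | Aψ ∈ ℓ²(ℤ)}`. -/
def jacobiMax (q : ℝ) : ℓ²(ℤ, ℂ) →ₗ.[ℂ] ℓ²(ℤ, ℂ) where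
  domain :=
    { carrier := {ψ | Memℓp (jacobiExpr q ψ) 2}
      add_mem' := by
        intro ψ χ hψ hχ
        have h := Memℓp.add hψ hχ
        rw [← map_add] at h
        exact h
      zero_mem' := by
        have h : jacobiExpr q ((0 : ℓ²(ℤ, ℂ)) : ℤ → ℂ) = 0 := map_zero (jacobiExpr q)
        change Memℓp (jacobiExpr q ((0 : ℓ²(ℤ, ℂ)) : ℤ → ℂ)) 2
        rw [h]
        exact zero_memℓp
      smul_mem' := by
        intro c ψ hψ
        have h := Memℓp.const_smul hψ c
        rw [← map_smul] at h
        exact h }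
  toFun :=
    { toFun := fun ψ => ⟨jacobiExpr q (ψ : ℓ²(ℤ, ℂ)), ψ.2⟩
      map_add' := fun ψ χ => Subtype.ext (map_add (jacobiExpr q) (ψ.1 : ℤ → ℂ) (χ.1 : ℤ → ℂ))
      map_smul' := fun c ψ => Subtype.ext (map_smul (jacobiExpr q) c (ψ.1 : ℤ → ℂ)) }

/-- The boundary condition at `+∞` labelled by `t ∈ ℝ ∪ {∞}`. -/
def boundaryCond (q : ℝ) : OnePoint ℝ → (ℤ → ℂ) → Prop
  | OnePoint.infty, ψ =>
      Tendsto (fun n : ℕ => (q : ℂ) ^ (-(n : ℤ)) * ψ (2 * n)) atTop (𝓝 0)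
  | OnePoint.some t, ψ =>
      Tendsto (fun n : ℕ => (q : ℂ) ^ (-(n : ℤ)) * (ψ (2 * n + 1) + (t : ℂ) * ψ (2 * n)))
        atTop (𝓝 0) ∧
      Tendsto (fun n : ℕ =>
          (q : ℂ) ^ (-(n : ℤ)) * ((q : ℂ) * ψ (2 * n - 1) - (t : ℂ) * ψ (2 * n)))
        atTop (𝓝 0)

/-- The sequences in `ℓ²(ℤ)` satisfying the boundary condition labelled by `t`. -/
def boundarySpace (q : ℝ) (t : OnePoint ℝ) : Submodule ℂ ℓ²(ℤ, ℂ) where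
  carrier := {ψ | boundaryCond q t ψ}
  add_mem' := by
    intro ψ χ hψ hχ
    cases t using OnePoint.rec with
    | infty =>
      have h := Tendsto.add hψ hχ
      rw [add_zero] at h
      refine h.congr fun n => ?_
      simp only [lp.coeFn_add, Pi.add_apply]
      ring
    | coe t =>
      refine ⟨(add_zero (0 : ℂ)) ▸ (Tendsto.add hψ.1 hχ.1).congr fun n => ?_,
        (add_zero (0 : ℂ)) ▸ (Tendsto.add hψ.2 hχ.2).congr fun n => ?_⟩ <;>
      · simp only [lp.coeFn_add, Pi.add_apply]
        ring
  zero_mem' := by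
    cases t using OnePoint.rec with
    | infty =>
      refine tendsto_const_nhds.congr fun n => ?_
      simp
    | coe t =>
      refine ⟨tendsto_const_nhds.congr fun n => ?_, tendsto_const_nhds.congr fun n => ?_⟩ <;>
      simp
  smul_mem' := by
    intro c ψ hψ
    cases t using OnePoint.rec with
    | infty =>
      have h := Tendsto.const_mul c hψ
      rw [mul_zero] at h
      refine h.congr fun n => ?_
      simp only [lp.coeFn_smul, Pi.smul_apply, smul_eq_mul]
      ring
    | coe t =>
      refine ⟨(mul_zero c) ▸ (Tendsto.const_mul c hψ.1).congr fun n => ?_,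
        (mul_zero c) ▸ (Tendsto.const_mul c hψ.2).congr fun n => ?_⟩ <;>
      · simp only [lp.coeFn_smul, Pi.smul_apply, smul_eq_mul]
        ring

/-- The operator `A_t`, `t ∈ ℝ ∪ {∞}`: the restriction of the maximal operator to those
`ψ ∈ D` that satisfy the boundary condition labelled by `t`. -/
def jacobiExt (q : ℝ) (t : OnePoint ℝ) : ℓ²(ℤ, ℂ) →ₗ.[ℂ] ℓ²(ℤ, ℂ) :=
  (jacobiMax q).domRestrict (boundarySpace q t)

/-- The eigenspace `{ψ ∈ Dom T | T ψ = x ψ}` of an unbounded operator `T`. -/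
def pmapEigenspace {E : Type*} [AddCommGroup E] [Module ℂ E] (T : E →ₗ.[ℂ] E) (x : ℂ) :
    Submodule ℂ T.domain :=
  LinearMap.ker (T.toFun - x • T.domain.subtype)

/-- The point spectrum (set of eigenvalues) of an unbounded operator. -/
def pointSpectrum {E : Type*} [AddCommGroup E] [Module ℂ E] (T : E →ₗ.[ℂ] E) : Set ℂ :=
  {x | pmapEigenspace T x ≠ ⊥}

end

/-!
For `x ≠ 0` the eigenvalue equation has the explicit solution `eigenSeq q x`, built from Ramanujan's
`q`-Airy function and decaying at `-∞`. The Casoratian `W` of two solutions satisfies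
`W (n + 1) = q W n`, so it vanishes as soon as both solutions are bounded, and every eigenvector is
a multiple of `eigenSeq q x`. Re-centring the `q`-Airy series at its largest term gives the limits
of `(-q)⁻ⁿ ψ (2n)` and `(-q)⁻ⁿ ψ (2n + 1)` at `+∞` as bilateral theta series, which are theta
functions by Jacobi's triple product; inserting them in the boundary condition gives the
characteristic equation. The boundary condition also makes the boundary term of Green's formula
vanish at both ends, whence `x.im * ∑ ‖ψ n‖ ^ 2 = 0` and `x` is real.
-/

section FiniteTripleProduct

open Finset

variable {K : Type*} [Field K]

/-- The reciprocal `1 / (p; p)_m` of a finite `q`-factorial in base `p`, with the usual convention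
that it vanishes for `m < 0`, so that bilateral series terminate where they should. -/
def qFactorialInv (p : K) : ℤ → K
  | .ofNat n => (∏ k ∈ range n, (1 - p * p ^ k))⁻¹
  | .negSucc _ => 0

/-- The term `(-1)ʲ p ^ (j (j - 1) / 2) yʲ` of the theta series of nome `p = s ^ 2`; the square
root `s` of the nome makes the exponent an integer without division. -/
def thetaTerm (s y : K) (j : ℤ) : K := (-1) ^ j * s ^ (j * (j - 1)) * y ^ j

lemma qFactorialInv_natCast (p : K) (n : ℕ) :
    qFactorialInv p n = (∏ k ∈ range n, (1 - p * p ^ k))⁻¹ := rfl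

lemma qFactorialInv_of_neg (p : K) {m : ℤ} (hm : m < 0) : qFactorialInv p m = 0 := by
  obtain ⟨n, rfl⟩ := Int.eq_negSucc_of_lt_zero hm
  rfl

lemma qFactorialInv_zero (p : K) : qFactorialInv p 0 = 1 := by
  simpa using qFactorialInv_natCast p 0

lemma one_sub_mul_pow_ne_zero {p : K} (hp : ¬IsOfFinOrder p) (k : ℕ) : 1 - p * p ^ k ≠ 0 :=
  fun h => hp <| isOfFinOrder_iff_pow_eq_one.2
    ⟨k + 1, k.succ_pos, by rw [pow_succ', ← sub_eq_zero.1 h]⟩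

lemma one_sub_zpow_mul_qFactorialInv {p : K} (hp : ¬IsOfFinOrder p) (m : ℤ) :
    (1 - p ^ m) * qFactorialInv p m = qFactorialInv p (m - 1) := by
  rcases lt_trichotomy m 0 with hm | rfl | hm
  · rw [qFactorialInv_of_neg p hm, qFactorialInv_of_neg p (by lia), mul_zero]
  · simp [qFactorialInv_of_neg]
  · obtain ⟨n, rfl⟩ : ∃ n : ℕ, m = (n + 1 : ℕ) := ⟨m.toNat - 1, by lia⟩
    have hn : ((n + 1 : ℕ) : ℤ) - 1 = n := by push_cast; ring
    rw [hn, zpow_natCast, qFactorialInv_natCast, qFactorialInv_natCast, prod_range_succ, pow_succ',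
      mul_inv_rev, mul_inv_cancel_left₀ (one_sub_mul_pow_ne_zero hp n)]

lemma one_sub_zpow_mul_qFactorialInv_mul {p : K} (hp0 : p ≠ 0) (hp : ¬IsOfFinOrder p) (m j : ℤ) :
    (1 - p ^ (m + 1)) * (qFactorialInv p j * qFactorialInv p (m + 1 - j)) =
      qFactorialInv p j * qFactorialInv p (m - j) +
        p ^ (m + 1 - j) * (qFactorialInv p (j - 1) * qFactorialInv p (m + 1 - j)) := by
  have h_split : p ^ (m + 1) = p ^ (m + 1 - j) * p ^ j := by rw [← zpow_add₀ hp0, sub_add_cancel]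
  have h_left := one_sub_zpow_mul_qFactorialInv hp j
  have h_right := one_sub_zpow_mul_qFactorialInv hp (m + 1 - j)
  rw [sub_right_comm, add_sub_cancel_right] at h_right
  rw [h_split, ← h_left, ← h_right]
  ring

lemma thetaTerm_zero (s y : K) : thetaTerm s y 0 = 1 := by simp [thetaTerm]

lemma thetaTerm_succ {s y : K} (hs : s ≠ 0) (hy : y ≠ 0) (j : ℤ) :
    thetaTerm s y (j + 1) = -(s ^ (2 * j) * y) * thetaTerm s y j := by
  rw [thetaTerm, thetaTerm, show (j + 1) * (j + 1 - 1) = 2 * j + j * (j - 1) by ring,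
    zpow_add₀ hs, zpow_add_one₀ (neg_ne_zero.2 one_ne_zero), zpow_add_one₀ hy]
  ring

lemma zpow_sub_mul_thetaTerm {s y : K} (hs : s ≠ 0) (hy : y ≠ 0) (m j : ℤ) :
    (s ^ 2) ^ (m + 1 - j) * thetaTerm s y j = -((s ^ 2) ^ m * y) * thetaTerm s y (j - 1) := by
  have h_exp : (s ^ 2) ^ (m + 1 - j) * s ^ (2 * (j - 1)) = (s ^ 2) ^ m := by
    rw [zpow_mul, zpow_ofNat, ← zpow_add₀ (pow_ne_zero 2 hs), sub_add_sub_cancel,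
      add_sub_cancel_right]
  rw [← h_exp, ← sub_add_cancel j 1, thetaTerm_succ hs hy, sub_add_cancel]
  ring

lemma thetaTerm_ne_zero {s y : K} (hs : s ≠ 0) (hy : y ≠ 0) (j : ℤ) : thetaTerm s y j ≠ 0 :=
  mul_ne_zero (mul_ne_zero (zpow_ne_zero _ (neg_ne_zero.2 one_ne_zero)) (zpow_ne_zero _ hs))
    (zpow_ne_zero _ hy)

lemma thetaTerm_mul (s a y : K) (j : ℤ) : thetaTerm s (a * y) j = a ^ j * thetaTerm s y j := by
  rw [thetaTerm, thetaTerm, mul_zpow]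
  ring

lemma thetaTerm_neg {s : K} (hs : s ≠ 0) (y : K) (j : ℤ) :
    thetaTerm s y (-j) = thetaTerm s (s ^ 2 * y⁻¹) j := by
  rw [thetaTerm_mul, thetaTerm, thetaTerm, show -j * (-j - 1) = 2 * j + j * (j - 1) by ring,
    zpow_add₀ hs, zpow_mul, zpow_neg, ← inv_zpow, inv_neg_one, zpow_neg, inv_zpow]
  norm_cast
  ring

lemma thetaTerm_add_mul_thetaTerm_neg {s y : K} (hs : s ≠ 0) (hy : y ≠ 0) (n j : ℤ) :
    thetaTerm s (s ^ (-(2 * n)) * y) (n + j) * thetaTerm s y (-n) = thetaTerm s y j := by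
  have h_sign : ((-1 : K) ^ (n + j)) * (-1) ^ (-n) = (-1) ^ j := by
    rw [← zpow_add₀ (neg_ne_zero.2 one_ne_zero), add_neg_cancel_comm]
  have h_nome : s ^ (-(2 * n) * (n + j)) * s ^ ((n + j) * (n + j - 1)) * s ^ (-n * (-n - 1)) =
      s ^ (j * (j - 1)) := by
    rw [← zpow_add₀ hs, ← zpow_add₀ hs]
    congr 1
    ring
  have h_arg : y ^ (n + j) * y ^ (-n) = y ^ j := by
    rw [← zpow_add₀ hy, add_neg_cancel_comm]
  rw [thetaTerm_mul, thetaTerm, thetaTerm, thetaTerm, ← zpow_mul, ← h_sign, ← h_nome, ← h_arg]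
  ring

lemma prod_one_sub_mul_thetaTerm_neg {s y : K} (hs : s ≠ 0) (hy : y ≠ 0) (N : ℕ) :
    (∏ k ∈ range N, (1 - y * ((s ^ 2) ^ (k + 1))⁻¹)) * thetaTerm s y (-N) =
      ∏ k ∈ range N, (1 - s ^ 2 * y⁻¹ * (s ^ 2) ^ k) := by
  induction N with
  | zero => simp [thetaTerm_zero]
  | succ N ih =>
    have h_term : thetaTerm s y (-(N + 1 : ℕ)) =
        -((s ^ 2) ^ (N + 1) * y⁻¹) * thetaTerm s y (-N) := by
      have hy' : s ^ 2 * y⁻¹ ≠ 0 := mul_ne_zero (pow_ne_zero 2 hs) (inv_ne_zero hy)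
      rw [thetaTerm_neg hs, thetaTerm_neg hs, Nat.cast_add_one, thetaTerm_succ hs hy', pow_succ,
        zpow_mul]
      norm_cast
      ring
    have h_factor : (1 - y * ((s ^ 2) ^ (N + 1))⁻¹) * -((s ^ 2) ^ (N + 1) * y⁻¹) =
        1 - s ^ 2 * y⁻¹ * (s ^ 2) ^ N := by
      field_simp
      ring
    rw [prod_range_succ, prod_range_succ, h_term, ← ih, ← h_factor]
    ring

lemma prod_range_add_one_sub_mul {p : K} (hp0 : p ≠ 0) (y : K) (N : ℕ) :
    ∏ k ∈ range (N + N), (1 - y * (p ^ N)⁻¹ * p ^ k) =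
      (∏ k ∈ range N, (1 - y * (p ^ (k + 1))⁻¹)) * ∏ k ∈ range N, (1 - y * p ^ k) := by
  rw [prod_range_add, ← prod_range_reflect (fun k => 1 - y * (p ^ (k + 1))⁻¹)]
  congr 1 <;> refine prod_congr rfl fun k hk => ?_
  · have hN : N = N - 1 - k + 1 + k := by have := mem_range.1 hk; lia
    have h_pow : (p ^ N)⁻¹ * p ^ k = (p ^ (N - 1 - k + 1))⁻¹ := by
      nth_rw 1 [hN]
      rw [pow_add, mul_inv, inv_mul_cancel_right₀ (pow_ne_zero _ hp0)]
    rw [mul_assoc, h_pow]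
  · rw [pow_add, mul_assoc, inv_mul_cancel_left₀ (pow_ne_zero _ hp0)]

variable [TopologicalSpace K] [IsTopologicalRing K]

theorem hasSum_qBinomial {s y : K} (hs : s ≠ 0) (hs2 : ¬IsOfFinOrder (s ^ 2)) (hy : y ≠ 0)
    (n : ℕ) :
    HasSum (fun j : ℤ => qFactorialInv (s ^ 2) j * qFactorialInv (s ^ 2) (n - j) * thetaTerm s y j)
      (qFactorialInv (s ^ 2) n * ∏ k ∈ range n, (1 - y * (s ^ 2) ^ k)) := by
  set R := qFactorialInv (s ^ 2)
  induction n with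
  | zero =>
    have h := hasSum_single (f := fun j : ℤ => R j * R ((0 : ℕ) - j) * thetaTerm s y j) 0
      fun j hj => by
        rcases hj.lt_or_gt with hj | hj
        · simp [R, qFactorialInv_of_neg _ hj]
        · simp [R, qFactorialInv_of_neg _ (neg_lt_zero.2 hj)]
    simpa [R, qFactorialInv_zero, thetaTerm_zero] using h
  | succ n ih =>
    have h_ne : 1 - (s ^ 2) ^ ((n : ℤ) + 1) ≠ 0 := by
      rw [zpow_add_one₀ (pow_ne_zero 2 hs), zpow_natCast, mul_comm]
      exact one_sub_mul_pow_ne_zero hs2 n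
    have h_shift := ((Equiv.subRight (1 : ℤ)).hasSum_iff.2 ih).mul_left (-((s ^ 2) ^ (n : ℤ) * y))
    refine (hasSum_mul_left_iff h_ne).1 ?_
    convert ih.add h_shift using 1
    · funext j
      simp only [Function.comp_apply, Equiv.subRight_apply]
      rw [← mul_assoc, Nat.cast_succ,
        one_sub_zpow_mul_qFactorialInv_mul (pow_ne_zero 2 hs) hs2 n j,
        show (n : ℤ) - (j - 1) = n + 1 - j by ring]
      linear_combination R (j - 1) * R (n + 1 - j) * zpow_sub_mul_thetaTerm hs hy n j
    · rw [← mul_assoc, Nat.cast_succ, one_sub_zpow_mul_qFactorialInv hs2, add_sub_cancel_right,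
        prod_range_succ, zpow_natCast]
      ring

theorem hasSum_finite_tripleProduct {s y : K} (hs : s ≠ 0) (hs2 : ¬IsOfFinOrder (s ^ 2))
    (hy : y ≠ 0) (N : ℕ) :
    HasSum (fun j : ℤ =>
        qFactorialInv (s ^ 2) (N + j) * qFactorialInv (s ^ 2) (N - j) * thetaTerm s y j)
      (qFactorialInv (s ^ 2) (N + N : ℕ) * (∏ k ∈ range N, (1 - y * (s ^ 2) ^ k)) *
        ∏ k ∈ range N, (1 - s ^ 2 * y⁻¹ * (s ^ 2) ^ k)) := by
  have hz : y * ((s ^ 2) ^ N)⁻¹ ≠ 0 :=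
    mul_ne_zero hy (inv_ne_zero (pow_ne_zero _ (pow_ne_zero 2 hs)))
  have hz_eq : y * ((s ^ 2) ^ N)⁻¹ = s ^ (-(2 * (N : ℤ))) * y := by
    rw [zpow_neg, zpow_mul, mul_comm y]
    norm_cast
  have h_value : qFactorialInv (s ^ 2) (N + N : ℕ) *
        (∏ k ∈ range (N + N), (1 - y * ((s ^ 2) ^ N)⁻¹ * (s ^ 2) ^ k)) * thetaTerm s y (-N) =
      qFactorialInv (s ^ 2) (N + N : ℕ) * (∏ k ∈ range N, (1 - y * (s ^ 2) ^ k)) *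
        ∏ k ∈ range N, (1 - s ^ 2 * y⁻¹ * (s ^ 2) ^ k) := by
    rw [prod_range_add_one_sub_mul (pow_ne_zero 2 hs), ← prod_one_sub_mul_thetaTerm_neg hs hy]
    ring
  have h_shift := ((Equiv.addLeft (N : ℤ)).hasSum_iff.2
    (hasSum_qBinomial hs hs2 hz (N + N))).mul_right (thetaTerm s y (-N))
  refine (h_value ▸ h_shift).congr_fun fun j => ?_
  simp only [Function.comp_apply, Equiv.coe_addLeft]
  rw [mul_assoc _ (thetaTerm s _ _), hz_eq, thetaTerm_add_mul_thetaTerm_neg hs hy, Nat.cast_add,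
    add_sub_add_left_eq_sub]

end FiniteTripleProduct

section TripleProduct

variable {p s y : ℂ}

lemma not_isOfFinOrder_of_norm_lt_one (hp : ‖p‖ < 1) : ¬IsOfFinOrder p :=
  fun h => hp.ne h.norm_eq_one

lemma norm_sq_lt_one (hp : ‖p‖ < 1) : ‖p ^ 2‖ < 1 := by
  rw [norm_pow]
  exact pow_lt_one₀ (norm_nonneg _) hp two_ne_zero

lemma summable_norm_neg_mul_pow (hp : ‖p‖ < 1) (a : ℂ) :
    Summable fun k : ℕ => ‖-(a * p ^ k)‖ := by
  simp only [norm_neg, norm_mul, norm_pow]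
  exact (summable_geometric_of_lt_one (norm_nonneg _) hp).mul_left _

lemma tendsto_prod_qPochInf (hp : ‖p‖ < 1) (a : ℂ) :
    Tendsto (fun n : ℕ => ∏ k ∈ Finset.range n, (1 - a * p ^ k)) atTop (𝓝 (qPochInf a p)) := by
  have h :=
    (multipliable_one_add_of_summable (summable_norm_neg_mul_pow hp a)).hasProd.tendsto_prod_nat
  simpa only [← sub_eq_add_neg, qPochInf] using h

lemma qPochInf_self_ne_zero (hp : ‖p‖ < 1) : qPochInf p p ≠ 0 := by
  have h := tprod_one_add_ne_zero_of_summable (f := fun k : ℕ => -(p * p ^ k))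
    (fun k => by
      simpa only [← sub_eq_add_neg] using
        one_sub_mul_pow_ne_zero (not_isOfFinOrder_of_norm_lt_one hp) k)
    (summable_norm_neg_mul_pow hp p)
  simpa only [← sub_eq_add_neg, qPochInf] using h

lemma tendsto_qFactorialInv_natCast (hp : ‖p‖ < 1) :
    Tendsto (fun n : ℕ => qFactorialInv p n) atTop (𝓝 (qPochInf p p)⁻¹) := by
  simp only [qFactorialInv_natCast]
  exact (tendsto_prod_qPochInf hp p).inv₀ (qPochInf_self_ne_zero hp)

lemma tendsto_qFactorialInv (hp : ‖p‖ < 1) :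
    Tendsto (qFactorialInv p) atTop (𝓝 (qPochInf p p)⁻¹) := by
  rw [← Nat.map_cast_int_atTop]
  exact tendsto_map'_iff.2 (tendsto_qFactorialInv_natCast hp)

lemma tendsto_qFactorialInv_natCast_add (hp : ‖p‖ < 1) (j : ℤ) :
    Tendsto (fun n : ℕ => qFactorialInv p (n + j)) atTop (𝓝 (qPochInf p p)⁻¹) :=
  (tendsto_qFactorialInv hp).comp (tendsto_atTop_add_const_right _ _ tendsto_natCast_atTop_atTop)

lemma exists_norm_qFactorialInv_le (hp : ‖p‖ < 1) : ∃ C : ℝ, ∀ m, ‖qFactorialInv p m‖ ≤ C := by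
  obtain ⟨C, hC⟩ := (tendsto_qFactorialInv_natCast hp).norm.bddAbove_range
  have hC_nat : ∀ n : ℕ, ‖qFactorialInv p n‖ ≤ C := fun n => hC ⟨n, rfl⟩
  refine ⟨C, fun m => ?_⟩
  rcases lt_or_ge m 0 with hm | hm
  · rw [qFactorialInv_of_neg p hm, norm_zero]
    exact (norm_nonneg _).trans (hC_nat 0)
  · lift m to ℕ using hm
    exact hC_nat m

lemma summable_norm_thetaTerm_natCast (hs : s ≠ 0) (hs1 : ‖s‖ < 1) (hy : y ≠ 0) :
    Summable fun n : ℕ => ‖thetaTerm s y n‖ := by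
  have h_ne : ∀ n : ℕ, ‖thetaTerm s y n‖ ≠ 0 := fun n =>
    norm_ne_zero_iff.2 (thetaTerm_ne_zero hs hy n)
  have h_ratio : ∀ n : ℕ,
      ‖(s ^ 2) ^ n‖ * ‖y‖ = ‖thetaTerm s y (n + 1 : ℕ)‖ / ‖thetaTerm s y n‖ := fun n => by
    rw [Nat.cast_add_one, thetaTerm_succ hs hy, norm_mul, mul_div_cancel_right₀ _ (h_ne n),
      norm_neg, norm_mul, zpow_mul]
    norm_cast
  have h_lim := ((tendsto_pow_atTop_nhds_zero_of_norm_lt_one (norm_sq_lt_one hs1)).norm).mul_const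
    ‖y‖
  rw [norm_zero, zero_mul] at h_lim
  refine summable_of_ratio_test_tendsto_lt_one one_pos (Eventually.of_forall h_ne) ?_
  simpa only [norm_norm, h_ratio] using h_lim

lemma summable_norm_thetaTerm (hs : s ≠ 0) (hs1 : ‖s‖ < 1) (hy : y ≠ 0) :
    Summable fun j : ℤ => ‖thetaTerm s y j‖ := by
  refine Summable.of_nat_of_neg (summable_norm_thetaTerm_natCast hs hs1 hy) ?_
  simp only [thetaTerm_neg hs]
  exact summable_norm_thetaTerm_natCast hs hs1 (mul_ne_zero (pow_ne_zero 2 hs) (inv_ne_zero hy))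

lemma tsum_thetaTerm_sq_mul_inv (hs : s ≠ 0) (y : ℂ) :
    ∑' j, thetaTerm s (s ^ 2 * y⁻¹) j = ∑' j, thetaTerm s y j := by
  simp only [← thetaTerm_neg hs]
  exact (Equiv.neg ℤ).tsum_eq (thetaTerm s y)

lemma tendsto_tsum_mul_thetaTerm (hs : s ≠ 0) (hs1 : ‖s‖ < 1) (hy : y ≠ 0) {ι : Type*}
    {l : Filter ι} [l.IsCountablyGenerated] {c : ι → ℤ → ℂ} {d : ℤ → ℂ} {C : ℝ}
    (hC : ∀ᶠ i in l, ∀ j, ‖c i j‖ ≤ C) (hc : ∀ j, Tendsto (c · j) l (𝓝 (d j))) :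
    Tendsto (fun i => ∑' j, c i j * thetaTerm s y j) l (𝓝 (∑' j, d j * thetaTerm s y j)) := by
  refine tendsto_tsum_of_dominated_convergence ((summable_norm_thetaTerm hs hs1 hy).mul_left C)
    (fun j => (hc j).mul_const _) (hC.mono fun i hi j => ?_)
  rw [norm_mul]
  gcongr
  exact hi j

/-- Jacobi's triple product identity. -/
theorem qTheta_eq_tsum (hs : s ≠ 0) (hs1 : ‖s‖ < 1) (hy : y ≠ 0) :
    qTheta (s ^ 2) y = (qPochInf (s ^ 2) (s ^ 2))⁻¹ * ∑' j, thetaTerm s y j := by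
  have hp1 := norm_sq_lt_one hs1
  obtain ⟨C, hC⟩ := exists_norm_qFactorialInv_le hp1
  set ρ := (qPochInf (s ^ 2) (s ^ 2))⁻¹
  have h_series : Tendsto (fun N : ℕ => ∑' j : ℤ, qFactorialInv (s ^ 2) (N + j) *
      qFactorialInv (s ^ 2) (N - j) * thetaTerm s y j) atTop
      (𝓝 (∑' j : ℤ, ρ * ρ * thetaTerm s y j)) := by
    refine tendsto_tsum_mul_thetaTerm hs hs1 hy (C := C * C)
      (Eventually.of_forall fun N j => ?_) fun j =>
        (tendsto_qFactorialInv_natCast_add hp1 j).mul (tendsto_qFactorialInv_natCast_add hp1 (-j))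
    rw [norm_mul]
    exact mul_le_mul (hC _) (hC _) (norm_nonneg _) ((norm_nonneg _).trans (hC 0))
  have h_double : Tendsto (fun N : ℕ => N + N) atTop atTop :=
    tendsto_atTop_mono (fun N => Nat.le_add_left N N) tendsto_id
  have h_product := (((tendsto_qFactorialInv_natCast hp1).comp h_double).mul
    (tendsto_prod_qPochInf hp1 y)).mul (tendsto_prod_qPochInf hp1 (s ^ 2 * y⁻¹))
  have h_eq : ∑' j : ℤ, ρ * ρ * thetaTerm s y j =
      ρ * qPochInf y (s ^ 2) * qPochInf (s ^ 2 * y⁻¹) (s ^ 2) :=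
    tendsto_nhds_unique h_series <| h_product.congr fun N =>
      (hasSum_finite_tripleProduct hs (not_isOfFinOrder_of_norm_lt_one hp1) hy N).tsum_eq.symm
  rw [tsum_mul_left, mul_assoc, mul_assoc] at h_eq
  exact (mul_left_cancel₀ (inv_ne_zero (qPochInf_self_ne_zero hp1)) h_eq).symm

end TripleProduct

section QAiry

variable {s y : ℂ}

/-- The entire function `∑_{k ≥ 0} (-1)ᵏ s ^ (k (k - 1)) yᵏ / (s; s)_k`, which is Ramanujan's
`q`-Airy function of base `s` at `y / s`. It is summed over `ℤ`, where the terms with `k < 0`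
vanish, so that the summation index can be shifted. -/
noncomputable def qAiry (s y : ℂ) : ℂ := ∑' k : ℤ, qFactorialInv s k * thetaTerm s y k

lemma hasSum_qAiry (hs : s ≠ 0) (hs1 : ‖s‖ < 1) (hy : y ≠ 0) :
    HasSum (fun k : ℤ => qFactorialInv s k * thetaTerm s y k) (qAiry s y) := by
  obtain ⟨C, hC⟩ := exists_norm_qFactorialInv_le hs1
  refine (Summable.of_norm_bounded ((summable_norm_thetaTerm hs hs1 hy).mul_left C)
    fun k => ?_).hasSum
  rw [norm_mul]
  gcongr
  exact hC k

lemma qAiry_recurrence (hs : s ≠ 0) (hs1 : ‖s‖ < 1) (hy : y ≠ 0) :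
    qAiry s (s⁻¹ * y) = qAiry s y - s⁻¹ * y * qAiry s (s * y) := by
  have h_shift := ((Equiv.subRight (1 : ℤ)).hasSum_iff.2
    (hasSum_qAiry hs hs1 (mul_ne_zero hs hy))).mul_left (s⁻¹ * y)
  refine (hasSum_qAiry hs hs1 (mul_ne_zero (inv_ne_zero hs) hy)).unique
    (((hasSum_qAiry hs hs1 hy).sub h_shift).congr_fun fun k => ?_)
  have h_term : s⁻¹ ^ k * thetaTerm s y k = -(s⁻¹ * y * thetaTerm s (s * y) (k - 1)) := by
    have h_pow : s⁻¹ ^ k * s ^ (2 * (k - 1)) = s⁻¹ * s ^ (k - 1) := by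
      rw [inv_zpow', ← zpow_add₀ hs, ← zpow_neg_one, ← zpow_add₀ hs]
      congr 1
      ring
    have h_succ := thetaTerm_succ hs hy (k - 1)
    rw [sub_add_cancel] at h_succ
    rw [h_succ, thetaTerm_mul]
    linear_combination -(y * thetaTerm s y (k - 1)) * h_pow
  have h_fact := one_sub_zpow_mul_qFactorialInv (not_isOfFinOrder_of_norm_lt_one hs1) k
  have h_inv : s⁻¹ ^ k * s ^ k = 1 := by rw [← mul_zpow, inv_mul_cancel₀ hs, one_zpow]
  simp only [Function.comp_apply, Equiv.subRight_apply]
  rw [← h_fact, thetaTerm_mul]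
  linear_combination (1 - s ^ k) * qFactorialInv s k * h_term +
    qFactorialInv s k * thetaTerm s y k * h_inv

lemma tendsto_thetaTerm_mul_qAiry (hs : s ≠ 0) (hs1 : ‖s‖ < 1) (hy : y ≠ 0) :
    Tendsto (fun n : ℕ => thetaTerm s y (-n) * qAiry s (s ^ (-(2 * (n : ℤ))) * y)) atTop
      (𝓝 ((qPochInf s s)⁻¹ * ∑' j, thetaTerm s y j)) := by
  obtain ⟨C, hC⟩ := exists_norm_qFactorialInv_le hs1
  rw [← tsum_mul_left]
  refine (tendsto_tsum_mul_thetaTerm hs hs1 hy (Eventually.of_forall fun (n : ℕ) j => hC (n + j))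
    (tendsto_qFactorialInv_natCast_add hs1)).congr fun n => ?_
  rw [qAiry, ← (Equiv.addLeft (n : ℤ)).tsum_eq fun k =>
    qFactorialInv s k * thetaTerm s (s ^ (-(2 * (n : ℤ))) * y) k, ← tsum_mul_left]
  refine tsum_congr fun j => ?_
  rw [Equiv.coe_addLeft, ← thetaTerm_add_mul_thetaTerm_neg hs hy n j]
  ring

lemma tendsto_qAiry_zero (hs : s ≠ 0) (hs1 : ‖s‖ < 1) : Tendsto (qAiry s) (𝓝 0) (𝓝 1) := by
  obtain ⟨C, hC⟩ := exists_norm_qFactorialInv_le hs1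
  have h_bound : ∀ᶠ y : ℂ in 𝓝 0, ∀ k : ℤ, ‖qFactorialInv s k * y ^ k‖ ≤ C := by
    filter_upwards [Metric.closedBall_mem_nhds (0 : ℂ) one_pos] with y hy k
    rw [mem_closedBall_zero_iff] at hy
    rcases lt_or_ge k 0 with hk | hk
    · rw [qFactorialInv_of_neg s hk, zero_mul, norm_zero]
      exact (norm_nonneg _).trans (hC 0)
    · lift k to ℕ using hk
      rw [norm_mul, zpow_natCast, norm_pow]
      exact (mul_le_of_le_one_right (norm_nonneg _) (pow_le_one₀ (norm_nonneg _) hy)).trans (hC k)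
  have h_term : ∀ k : ℤ, Tendsto (fun y : ℂ => qFactorialInv s k * y ^ k) (𝓝 0)
      (𝓝 (qFactorialInv s k * 0 ^ k)) := fun k => by
    rcases lt_or_ge k 0 with hk | hk
    · simp [qFactorialInv_of_neg s hk]
    · exact (continuousAt_zpow₀ 0 k (.inr hk)).tendsto.const_mul _
  have h_sum : ∑' k : ℤ, qFactorialInv s k * 0 ^ k * thetaTerm s 1 k = 1 := by
    rw [tsum_eq_single 0 fun k hk => by rw [zero_zpow k hk, mul_zero, zero_mul]]
    simp [qFactorialInv_zero, thetaTerm_zero]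
  refine h_sum ▸ (tendsto_tsum_mul_thetaTerm hs hs1 one_ne_zero h_bound h_term).congr fun y => ?_
  refine tsum_congr fun k => ?_
  rw [mul_assoc, ← thetaTerm_mul, mul_one]

end QAiry

section Solutions

open scoped ENNReal

/-- The three-term recurrence that the eigenvalue equation `jacobiExpr q ψ = x • ψ` becomes when
solved for `ψ (n + 1)`. -/
def IsJacobiSolution {K : Type*} [Field K] (q x : K) (ψ : ℤ → K) : Prop :=
  ∀ n, ψ (n + 1) = x * q ^ n * ψ n - q * ψ (n - 1)

/-- The Casoratian, the discrete analogue of the Wronskian, of two sequences. -/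
def casoratian {R : Type*} [Ring R] (ψ χ : ℤ → R) (n : ℤ) : R :=
  ψ (n + 1) * χ n - ψ n * χ (n + 1)

lemma jacobiExpr_eq_smul_iff {q : ℝ} (hq : (q : ℂ) ≠ 0) {x : ℂ} {ψ : ℤ → ℂ} :
    jacobiExpr q ψ = x • ψ ↔ IsJacobiSolution (q : ℂ) x ψ := by
  refine funext_iff.trans <| forall_congr' fun n => ?_
  have hn : (q : ℂ) ^ n ≠ 0 := zpow_ne_zero n hq
  change (q : ℂ) ^ (-n + 1) * ψ (n - 1) + (q : ℂ) ^ (-n) * ψ (n + 1) = x * ψ n ↔ _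
  rw [zpow_add_one₀ hq, zpow_neg, mul_assoc, ← mul_add, inv_mul_eq_iff_eq_mul₀ hn,
    eq_sub_iff_add_eq', mul_left_comm, mul_assoc]

namespace IsJacobiSolution

section Field

variable {K : Type*} [Field K] {q x : K} {ψ χ : ℤ → K}

lemma sub_smul (hψ : IsJacobiSolution q x ψ) (hχ : IsJacobiSolution q x χ) (c : K) :
    IsJacobiSolution q x (ψ - c • χ) := fun n => by
  simp only [Pi.sub_apply, Pi.smul_apply, smul_eq_mul]
  rw [hψ n, hχ n]
  ring

lemma casoratian_succ (hψ : IsJacobiSolution q x ψ) (hχ : IsJacobiSolution q x χ) (n : ℤ) :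
    casoratian ψ χ (n + 1) = q * casoratian ψ χ n := by
  rw [casoratian, casoratian, hψ (n + 1), hχ (n + 1), add_sub_cancel_right]
  ring

lemma eq_zero_of_consecutive_zeros (hψ : IsJacobiSolution q x ψ) (hq : q ≠ 0) {n : ℤ}
    (hn : ψ n = 0) (hn_succ : ψ (n + 1) = 0) : ψ = 0 := by
  have h_pair : ∀ m, ψ m = 0 ∧ ψ (m + 1) = 0 := fun m => by
    induction m using Int.inductionOn' (b := n) with
    | zero => exact ⟨hn, hn_succ⟩
    | succ m _ ih => exact ⟨ih.2, by simpa [ih.1, ih.2] using hψ (m + 1)⟩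
    | pred m _ ih => exact ⟨by simpa [ih.1, ih.2, hq] using hψ m, by simpa using ih.1⟩
  exact funext fun m => (h_pair m).1

end Field

end IsJacobiSolution

variable {𝕜 : Type*} [NormedField 𝕜] {q x : 𝕜} {ψ χ : ℤ → 𝕜}

lemma eq_zero_of_forall_add_eq_mul {f : ℤ → 𝕜} (hf : Memℓp f ∞) {c : 𝕜} (hc : ‖c‖ < 1) {d : ℤ}
    (h : ∀ n, f (n + d) = c * f n) : f = 0 := by
  obtain ⟨B, hB⟩ := memℓp_infty_iff.1 hf
  funext n
  have h_iterate : ∀ k : ℕ, f n = c ^ k * f (n - k * d) := fun k => by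
    induction k with
    | zero => simp
    | succ k ih =>
      rw [ih, show n - k * d = n - (k + 1 : ℕ) * d + d by push_cast; ring, h, pow_succ, mul_assoc]
  have h_bound : ∀ k : ℕ, ‖f n‖ ≤ ‖c‖ ^ k * B := fun k => by
    rw [h_iterate k, norm_mul, norm_pow]
    gcongr
    exact hB ⟨_, rfl⟩
  have h_lim := (tendsto_pow_atTop_nhds_zero_of_lt_one (norm_nonneg c) hc).mul_const B
  rw [zero_mul] at h_lim
  exact norm_le_zero_iff.1 (ge_of_tendsto' h_lim h_bound)

lemma memℓp_infty_casoratian (hψ : Memℓp ψ ∞) (hχ : Memℓp χ ∞) : Memℓp (casoratian ψ χ) ∞ := by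
  have h_shift : ∀ {f : ℤ → 𝕜}, Memℓp f ∞ → Memℓp (fun n => f (n + 1)) ∞ := fun {f} hf =>
    memℓp_infty <| (memℓp_infty_iff.1 hf).mono <| by
      rintro _ ⟨n, rfl⟩
      exact ⟨n + 1, rfl⟩
  exact ((h_shift hψ).infty_mul hχ).sub (hψ.infty_mul (h_shift hχ))

namespace IsJacobiSolution

lemma casoratian_eq_zero (hψ : IsJacobiSolution q x ψ) (hχ : IsJacobiSolution q x χ)
    (hq1 : ‖q‖ < 1) (hψb : Memℓp ψ ∞) (hχb : Memℓp χ ∞) : casoratian ψ χ = 0 :=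
  eq_zero_of_forall_add_eq_mul (memℓp_infty_casoratian hψb hχb) hq1 (hψ.casoratian_succ hχ)

theorem exists_eq_smul (hψ : IsJacobiSolution q x ψ) (hχ : IsJacobiSolution q x χ) (hq : q ≠ 0)
    (hq1 : ‖q‖ < 1) (hψb : Memℓp ψ ∞) (hχb : Memℓp χ ∞) (hχ0 : χ ≠ 0) : ∃ c : 𝕜, ψ = c • χ := by
  obtain ⟨n, hn⟩ : ∃ n, χ n ≠ 0 := Function.ne_iff.1 hχ0
  refine ⟨ψ n / χ n, sub_eq_zero.1 <|
    (hψ.sub_smul hχ _).eq_zero_of_consecutive_zeros hq (n := n) ?_ ?_⟩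
  · simp [div_mul_cancel₀ _ hn]
  · have h_cas : ψ (n + 1) * χ n - ψ n * χ (n + 1) = 0 :=
      congrFun (hψ.casoratian_eq_zero hχ hq1 hψb hχb) n
    simp only [Pi.sub_apply, Pi.smul_apply, smul_eq_mul]
    field_simp
    linear_combination h_cas

lemma eq_zero_of_eigenvalue_zero (hψ : IsJacobiSolution q 0 ψ) (hq1 : ‖q‖ < 1)
    (hψb : Memℓp ψ ∞) : ψ = 0 := by
  refine eq_zero_of_forall_add_eq_mul hψb (c := -q) (d := 2) (by rwa [norm_neg]) fun n => ?_
  simpa [add_assoc] using hψ (n + 1)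

end IsJacobiSolution

end Solutions

section BoundaryValues

/-- The boundary values `a` and `b` of `ψ` at `+∞`: `ψ (2n)` and `ψ (2n + 1)` behave like `a (-q)ⁿ`
and `b (-q)ⁿ`, as they do for the solutions of the limiting recurrence
`ψ (n + 1) = -q * ψ (n - 1)`. -/
structure HasBoundaryValues (q : ℂ) (ψ : ℤ → ℂ) (a b : ℂ) : Prop where
  even : Tendsto (fun n : ℕ => (-q) ^ (-(n : ℤ)) * ψ (2 * n)) atTop (𝓝 a)
  odd : Tendsto (fun n : ℕ => (-q) ^ (-(n : ℤ)) * ψ (2 * n + 1)) atTop (𝓝 b)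

lemma tendsto_neg_zpow_mul_zero_iff {q : ℂ} {f : ℕ → ℂ} :
    Tendsto (fun n : ℕ => (-q) ^ (-(n : ℤ)) * f n) atTop (𝓝 0) ↔
      Tendsto (fun n : ℕ => q ^ (-(n : ℤ)) * f n) atTop (𝓝 0) := by
  refine tendsto_zero_iff_norm_tendsto_zero.trans <|
    Iff.trans ?_ tendsto_zero_iff_norm_tendsto_zero.symm
  simp only [norm_mul, norm_zpow, norm_neg]

lemma summable_norm_sq_of_tendsto_neg_zpow_mul {q : ℂ} (hq : q ≠ 0) (hq1 : ‖q‖ < 1) {f : ℕ → ℂ}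
    {L : ℂ} (h : Tendsto (fun n : ℕ => (-q) ^ (-(n : ℤ)) * f n) atTop (𝓝 L)) :
    Summable fun n => ‖f n‖ ^ 2 := by
  have h_geom := summable_geometric_of_lt_one (norm_nonneg _) (norm_sq_lt_one hq1)
  refine (h_geom.norm.mul_tendsto_const (Nat.cofinite_eq_atTop ▸ h.norm.pow 2)).congr fun n => ?_
  have h_norm : ‖q‖ ^ n ≠ 0 := pow_ne_zero n (norm_ne_zero_iff.2 hq)
  rw [norm_mul, norm_zpow, norm_neg, zpow_neg, zpow_natCast, norm_pow, mul_pow, inv_pow,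
    ← pow_mul', pow_mul, ← mul_assoc, mul_inv_cancel₀ (pow_ne_zero 2 h_norm), one_mul]

namespace HasBoundaryValues

variable {q a b : ℂ} {ψ : ℤ → ℂ}

lemma summable_norm_sq_natCast (h : HasBoundaryValues q ψ a b) (hq : q ≠ 0) (hq1 : ‖q‖ < 1) :
    Summable fun n : ℕ => ‖ψ n‖ ^ 2 := by
  have h_even := summable_norm_sq_of_tendsto_neg_zpow_mul hq hq1 h.even
  have h_odd := summable_norm_sq_of_tendsto_neg_zpow_mul hq hq1 h.odd
  exact (HasSum.even_add_odd (f := fun n : ℕ => ‖ψ n‖ ^ 2) (by simpa using h_even.hasSum)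
    (by simpa using h_odd.hasSum)).summable

lemma tendsto_odd_pred (h : HasBoundaryValues q ψ a b) (hq : q ≠ 0) :
    Tendsto (fun n : ℕ => (-q) ^ (-(n : ℤ)) * (q * ψ (2 * n - 1))) atTop (𝓝 (-b)) := by
  refine (tendsto_add_atTop_iff_nat 1).1 (h.odd.neg.congr fun n => ?_)
  have h_pow : (-q) ^ (-((n + 1 : ℕ) : ℤ)) * q = -(-q) ^ (-(n : ℤ)) := by
    rw [Nat.cast_succ, neg_add, zpow_add₀ (neg_ne_zero.2 hq), zpow_neg_one, inv_neg, mul_neg,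
      neg_mul, inv_mul_cancel_right₀ hq]
  rw [← mul_assoc, h_pow, neg_mul]
  congr 3
  push_cast
  ring

end HasBoundaryValues

variable {q : ℝ} {a b : ℂ} {ψ : ℤ → ℂ}

lemma HasBoundaryValues.boundaryCond_infty_iff (h : HasBoundaryValues q ψ a b) :
    boundaryCond q OnePoint.infty ψ ↔ a = 0 :=
  tendsto_neg_zpow_mul_zero_iff.symm.trans
    ⟨tendsto_nhds_unique h.even, fun ha => ha ▸ h.even⟩

lemma HasBoundaryValues.boundaryCond_coe_iff (h : HasBoundaryValues q ψ a b) (hq : (q : ℂ) ≠ 0)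
    (t : ℝ) : boundaryCond q (t : OnePoint ℝ) ψ ↔ b + t * a = 0 := by
  have h_succ : Tendsto (fun n : ℕ => (-q : ℂ) ^ (-(n : ℤ)) * (ψ (2 * n + 1) + t * ψ (2 * n)))
      atTop (𝓝 (b + t * a)) :=
    (h.odd.add (h.even.const_mul (t : ℂ))).congr fun n => by ring
  have h_pred : Tendsto (fun n : ℕ =>
      (-q : ℂ) ^ (-(n : ℤ)) * (q * ψ (2 * n - 1) - t * ψ (2 * n))) atTop (𝓝 (-(b + t * a))) := by
    rw [neg_add']
    exact ((h.tendsto_odd_pred hq).sub (h.even.const_mul (t : ℂ))).congr fun n => by ring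
  refine (and_congr tendsto_neg_zpow_mul_zero_iff tendsto_neg_zpow_mul_zero_iff).symm.trans
    ⟨fun ht => tendsto_nhds_unique h_succ ht.1, fun hab => ⟨hab ▸ h_succ, ?_⟩⟩
  rwa [hab, neg_zero] at h_pred

end BoundaryValues

section EigenSeq

open scoped ENNReal

variable {q x : ℂ}

/-- For `x ≠ 0`, the solution of `ψ (n + 1) = x q ^ n ψ n - q ψ (n - 1)` that decays at `-∞`. The
exponent `n * (n - 1) / 2` is an exact division. -/
noncomputable def eigenSeq (q x : ℂ) (n : ℤ) : ℂ :=
  x ^ n * q ^ (n * (n - 1) / 2) * qAiry (q ^ 2) (q ^ 4 * ((q ^ n * x) ^ 2)⁻¹)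

/-- The constant that multiplies the theta functions in the boundary values of `eigenSeq`. -/
noncomputable def boundaryConst (q : ℂ) : ℂ :=
  qPochInf (q ^ 4) (q ^ 4) / qPochInf (q ^ 2) (q ^ 2)

lemma norm_pow_four_lt_one (hq1 : ‖q‖ < 1) : ‖q ^ 4‖ < 1 := by
  rw [norm_pow]
  exact pow_lt_one₀ (norm_nonneg _) hq1 four_ne_zero

lemma boundaryConst_ne_zero (hq1 : ‖q‖ < 1) : boundaryConst q ≠ 0 :=
  div_ne_zero (qPochInf_self_ne_zero (norm_pow_four_lt_one hq1))
    (qPochInf_self_ne_zero (norm_sq_lt_one hq1))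

lemma zpow_triangle_succ (hq : q ≠ 0) (n : ℤ) :
    q ^ ((n + 1) * (n + 1 - 1) / 2) = q ^ n * q ^ (n * (n - 1) / 2) := by
  rw [← zpow_add₀ hq, show (n + 1) * (n + 1 - 1) = n * (n - 1) + n * 2 by ring,
    Int.add_mul_ediv_right _ _ two_ne_zero, add_comm]

lemma zpow_triangle_sq (q : ℂ) (n : ℤ) : (q ^ (n * (n - 1) / 2)) ^ 2 = q ^ (n * (n - 1)) := by
  rw [← zpow_natCast, ← zpow_mul]
  exact congrArg _ (Int.ediv_mul_cancel (Int.even_mul_pred_self n).two_dvd)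

lemma eigenSeq_succ (hq : q ≠ 0) (hx : x ≠ 0) (n : ℤ) :
    eigenSeq q x (n + 1) = x * eigenSeq q (q * x) n := by
  rw [eigenSeq, eigenSeq, zpow_triangle_succ hq, zpow_add_one₀ hx, mul_zpow, zpow_add_one₀ hq,
    mul_assoc (q ^ n) q x]
  ring

theorem isJacobiSolution_eigenSeq (hq : q ≠ 0) (hq1 : ‖q‖ < 1) (hx : x ≠ 0) :
    IsJacobiSolution q x (eigenSeq q x) := fun n => by
  have hz : q ^ n * x ≠ 0 := mul_ne_zero (zpow_ne_zero n hq) hx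
  have h_prefactor : x ^ n * q ^ (n * (n - 1) / 2) =
      q⁻¹ * (q ^ n * x) * (x ^ (n - 1) * q ^ ((n - 1) * (n - 1 - 1) / 2)) := by
    have h := zpow_triangle_succ hq (n - 1)
    rw [sub_add_cancel] at h
    rw [h, zpow_sub_one₀ hq, zpow_sub_one₀ hx]
    field_simp
  have h_prefactor_succ : x ^ (n + 1) * q ^ ((n + 1) * (n + 1 - 1) / 2) =
      q ^ n * x * (x ^ n * q ^ (n * (n - 1) / 2)) := by
    rw [zpow_triangle_succ hq, zpow_add_one₀ hx]
    ring
  rw [eigenSeq, eigenSeq, eigenSeq, h_prefactor_succ, h_prefactor, zpow_add_one₀ hq,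
    zpow_sub_one₀ hq, mul_right_comm _ q x, mul_right_comm _ q⁻¹ x, mul_comm x]
  generalize q ^ n * x = z at hz ⊢
  have h_next : q ^ 4 * ((z * q) ^ 2)⁻¹ = (q ^ 2)⁻¹ * (q ^ 4 * (z ^ 2)⁻¹) := by
    rw [mul_pow, mul_inv]
    ring
  have h_prev : q ^ 4 * ((z * q⁻¹) ^ 2)⁻¹ = q ^ 2 * (q ^ 4 * (z ^ 2)⁻¹) := by
    rw [mul_pow, mul_inv, inv_pow, inv_inv]
    ring
  rw [h_next, h_prev, qAiry_recurrence (pow_ne_zero 2 hq) (norm_sq_lt_one hq1)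
    (mul_ne_zero (pow_ne_zero 4 hq) (inv_ne_zero (pow_ne_zero 2 hz)))]
  field_simp

lemma neg_zpow_mul_eigenSeq_even (hq : q ≠ 0) (hx : x ≠ 0) (n : ℕ) :
    (-q) ^ (-(n : ℤ)) * eigenSeq q x (2 * n) =
      thetaTerm (q ^ 2) ((q ^ 2) ^ 2 * (x ^ 2)⁻¹) (-n) *
        qAiry (q ^ 2) ((q ^ 2) ^ (-(2 * (n : ℤ))) * ((q ^ 2) ^ 2 * (x ^ 2)⁻¹)) := by
  have h_arg : q ^ 4 * ((q ^ (2 * (n : ℤ)) * x) ^ 2)⁻¹ =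
      (q ^ 2) ^ (-(2 * (n : ℤ))) * ((q ^ 2) ^ 2 * (x ^ 2)⁻¹) := by
    rw [mul_pow, mul_inv, zpow_neg, ← zpow_natCast (q ^ _) 2, zpow_comm, zpow_natCast]
    ring
  have h_prefactor : (-q) ^ (-(n : ℤ)) * (x ^ (2 * (n : ℤ)) * q ^ (2 * (n : ℤ) * (2 * n - 1) / 2)) =
      thetaTerm (q ^ 2) ((q ^ 2) ^ 2 * (x ^ 2)⁻¹) (-n) := by
    have h_exp : (2 * (n : ℤ) * (2 * n - 1) / 2) = 2 * (n * (n - 1)) + n := by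
      rw [mul_assoc, Int.mul_ediv_cancel_left _ two_ne_zero]
      ring
    have h_base : (q ^ 2) ^ 2 * ((q ^ 2) ^ 2 * (x ^ 2)⁻¹)⁻¹ = x ^ 2 := by
      rw [mul_inv, inv_inv, mul_inv_cancel_left₀ (pow_ne_zero 2 (pow_ne_zero 2 hq))]
    rw [thetaTerm_neg (pow_ne_zero 2 hq), h_base, thetaTerm, h_exp, zpow_add₀ hq, zpow_mul q 2,
      zpow_mul x 2, neg_eq_neg_one_mul q, mul_zpow, zpow_neg q, zpow_neg (-1), ← inv_zpow,
      inv_neg_one]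
    norm_cast
    field_simp
  rw [eigenSeq, ← mul_assoc, h_arg, h_prefactor]

lemma tendsto_eigenSeq_even (hq : q ≠ 0) (hq1 : ‖q‖ < 1) (hx : x ≠ 0) :
    Tendsto (fun n : ℕ => (-q) ^ (-(n : ℤ)) * eigenSeq q x (2 * n)) atTop
      (𝓝 (boundaryConst q * qTheta (q ^ 4) (x ^ 2))) := by
  have hs := pow_ne_zero 2 hq
  have hs1 := norm_sq_lt_one hq1
  have hx2 := pow_ne_zero 2 hx
  have h_lim := tendsto_thetaTerm_mul_qAiry hs hs1
    (mul_ne_zero (pow_ne_zero 2 hs) (inv_ne_zero hx2))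
  rw [tsum_thetaTerm_sq_mul_inv hs] at h_lim
  have h_value : boundaryConst q * qTheta (q ^ 4) (x ^ 2) =
      (qPochInf (q ^ 2) (q ^ 2))⁻¹ * ∑' j, thetaTerm (q ^ 2) (x ^ 2) j := by
    have h_ne := qPochInf_self_ne_zero (norm_pow_four_lt_one hq1)
    have h_triple := qTheta_eq_tsum hs hs1 hx2
    rw [← pow_mul] at h_triple
    rw [boundaryConst, h_triple, div_mul_eq_mul_div, mul_inv_cancel_left₀ h_ne, div_eq_inv_mul]
  rw [h_value]
  simpa only [neg_zpow_mul_eigenSeq_even hq hx] using h_lim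

theorem hasBoundaryValues_eigenSeq (hq : q ≠ 0) (hq1 : ‖q‖ < 1) (hx : x ≠ 0) :
    HasBoundaryValues q (eigenSeq q x) (boundaryConst q * qTheta (q ^ 4) (x ^ 2))
      (boundaryConst q * (x * qTheta (q ^ 4) (q ^ 2 * x ^ 2))) where
  even := tendsto_eigenSeq_even hq hq1 hx
  odd := by
    have h := (tendsto_eigenSeq_even hq hq1 (mul_ne_zero hq hx)).const_mul x
    rw [mul_pow, mul_left_comm] at h
    exact h.congr fun n => by rw [eigenSeq_succ hq hx, mul_left_comm]

lemma tendsto_qAiry_eigenSeq (hq : q ≠ 0) (hq1 : ‖q‖ < 1) (x : ℂ) :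
    Tendsto (fun n : ℕ => qAiry (q ^ 2) (q ^ 4 * ((q ^ (-(n : ℤ)) * x) ^ 2)⁻¹)) atTop (𝓝 1) := by
  refine (tendsto_qAiry_zero (pow_ne_zero 2 hq) (norm_sq_lt_one hq1)).comp ?_
  have h := ((tendsto_pow_atTop_nhds_zero_of_norm_lt_one hq1).pow 2).const_mul (q ^ 4 * (x ^ 2)⁻¹)
  rw [zero_pow two_ne_zero, mul_zero] at h
  refine h.congr fun n => ?_
  rw [zpow_neg, zpow_natCast, mul_pow, mul_inv, inv_pow, inv_inv]
  ring

lemma eigenSeq_ne_zero (hq : q ≠ 0) (hq1 : ‖q‖ < 1) (hx : x ≠ 0) : eigenSeq q x ≠ 0 := by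
  obtain ⟨n, hn⟩ := ((tendsto_qAiry_eigenSeq hq hq1 x).eventually_ne one_ne_zero).exists
  exact Function.ne_iff.2 ⟨-n, mul_ne_zero (mul_ne_zero (zpow_ne_zero _ hx) (zpow_ne_zero _ hq)) hn⟩

lemma norm_eigenSeq_sq (q x : ℂ) (n : ℤ) :
    ‖eigenSeq q x n‖ ^ 2 =
      ‖thetaTerm q (x ^ 2) n‖ * ‖qAiry (q ^ 2) (q ^ 4 * ((q ^ n * x) ^ 2)⁻¹)‖ ^ 2 := by
  have h_prefactor : ‖x ^ n * q ^ (n * (n - 1) / 2)‖ ^ 2 = ‖thetaTerm q (x ^ 2) n‖ := by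
    rw [← norm_pow, mul_pow, zpow_triangle_sq, thetaTerm, mul_assoc, norm_mul _ (_ * _), norm_zpow,
      norm_neg, norm_one, one_zpow, one_mul, mul_comm, ← zpow_natCast (x ^ n), zpow_comm,
      zpow_natCast]
  rw [eigenSeq, norm_mul, mul_pow, h_prefactor]

theorem memℓp_eigenSeq (hq : q ≠ 0) (hq1 : ‖q‖ < 1) (hx : x ≠ 0) : Memℓp (eigenSeq q x) 2 := by
  refine memℓp_gen ?_
  simp only [ENNReal.toReal_ofNat, Real.rpow_ofNat]
  refine Summable.of_nat_of_neg
    ((hasBoundaryValues_eigenSeq hq hq1 hx).summable_norm_sq_natCast hq hq1) ?_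
  simp only [norm_eigenSeq_sq]
  exact ((summable_norm_thetaTerm hq hq1 (pow_ne_zero 2 hx)).comp_injective
    (neg_injective.comp Nat.cast_injective)).norm.mul_tendsto_const
      (Nat.cofinite_eq_atTop ▸ (tendsto_qAiry_eigenSeq hq hq1 x).norm.pow 2)

theorem IsJacobiSolution.exists_eq_smul_eigenSeq {ψ : ℤ → ℂ} (hψ : IsJacobiSolution q x ψ)
    (hq : q ≠ 0) (hq1 : ‖q‖ < 1) (hx : x ≠ 0) (hψb : Memℓp ψ ∞) : ∃ c : ℂ, ψ = c • eigenSeq q x :=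
  hψ.exists_eq_smul (isJacobiSolution_eigenSeq hq hq1 hx) hq hq1 hψb
    ((memℓp_eigenSeq hq hq1 hx).of_exponent_ge le_top) (eigenSeq_ne_zero hq hq1 hx)

end EigenSeq

section GreenFlux

open scoped ComplexConjugate ENNReal

/-- The boundary term in Green's formula for `jacobiExpr q` applied to `ψ` and its conjugate, up to
the factor `2 * I`. -/
noncomputable def greenFlux (q : ℝ) (ψ : ℤ → ℂ) (n : ℤ) : ℝ :=
  q ^ (-n) * (ψ (n + 1) * conj (ψ n)).im

variable {q : ℝ} {x : ℂ} {ψ : ℤ → ℂ}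

lemma IsJacobiSolution.greenFlux_succ (hψ : IsJacobiSolution (q : ℂ) x ψ) (hq : q ≠ 0) (n : ℤ) :
    greenFlux q ψ (n + 1) = greenFlux q ψ n + x.im * ‖ψ (n + 1)‖ ^ 2 := by
  have hn : q ^ n ≠ 0 := zpow_ne_zero n hq
  have h_step : ψ (n + 2) = x * (q ^ (n + 1) : ℝ) * ψ (n + 1) - q * ψ n := by
    have h := hψ (n + 1)
    rw [add_assoc, add_sub_cancel_right] at h
    exact_mod_cast h
  rw [greenFlux, greenFlux, add_assoc, one_add_one_eq_two, h_step, ← Complex.normSq_eq_norm_sq,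
    zpow_neg, zpow_neg, zpow_add_one₀ hq, Complex.normSq_apply]
  simp only [Complex.mul_im, Complex.mul_re, Complex.sub_im, Complex.sub_re, Complex.conj_re,
    Complex.conj_im, Complex.ofReal_re, Complex.ofReal_im]
  field_simp
  ring

lemma tendsto_greenFlux_atBot (hq1 : |q| < 1) (hψ : Memℓp ψ ∞) :
    Tendsto (greenFlux q ψ) atBot (𝓝 0) := by
  obtain ⟨B, hB⟩ := memℓp_infty_iff.1 hψ
  have h_bound : ∀ n, ‖ψ n‖ ≤ B := fun n => hB ⟨n, rfl⟩
  have h_geom : Tendsto (fun n : ℤ => |q| ^ (-n)) atBot (𝓝 0) := by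
    refine Tendsto.comp (g := fun n : ℤ => |q| ^ n) ?_ tendsto_neg_atBot_atTop
    rw [← Nat.map_cast_int_atTop, tendsto_map'_iff]
    simpa [Function.comp_def] using tendsto_pow_atTop_nhds_zero_of_lt_one (abs_nonneg q) hq1
  have h_lim := h_geom.mul_const (B * B)
  rw [zero_mul] at h_lim
  refine squeeze_zero_norm (fun n => ?_) h_lim
  rw [greenFlux, norm_mul, norm_zpow, Real.norm_eq_abs, Real.norm_eq_abs]
  refine mul_le_mul_of_nonneg_left ((Complex.abs_im_le_norm _).trans ?_) (by positivity)
  rw [norm_mul, RCLike.norm_conj]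
  exact mul_le_mul (h_bound _) (h_bound _) (norm_nonneg _) ((norm_nonneg _).trans (h_bound 0))

lemma HasBoundaryValues.tendsto_greenFlux {a b : ℂ} (h : HasBoundaryValues (q : ℂ) ψ a b) :
    Tendsto (fun n : ℕ => greenFlux q ψ (2 * n)) atTop (𝓝 (b * conj a).im) := by
  refine ((Complex.continuous_im.tendsto _).comp
    (h.odd.mul ((Complex.continuous_conj.tendsto _).comp h.even))).congr fun n => ?_
  have h_real : ∀ z w : ℂ, (-q : ℂ) ^ (-(n : ℤ)) * z * conj ((-q : ℂ) ^ (-(n : ℤ)) * w) =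
      (q ^ (-(2 * (n : ℤ))) : ℝ) * (z * conj w) := fun z w => by
    rw [map_mul, map_zpow₀, map_neg, Complex.conj_ofReal, mul_mul_mul_comm, ← mul_zpow,
      neg_mul_neg, ← sq, ← zpow_natCast, ← zpow_mul, Nat.cast_ofNat, mul_neg]
    norm_cast
  rw [Function.comp_apply, Function.comp_apply, h_real, Complex.im_ofReal_mul, greenFlux]

theorem IsJacobiSolution.im_eq_zero_of_tendsto_greenFlux (hψ : IsJacobiSolution (q : ℂ) x ψ)
    (hq : q ≠ 0) (hq1 : |q| < 1) (hψb : Memℓp ψ ∞) (hψ0 : ψ ≠ 0)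
    (h_top : Tendsto (fun n : ℕ => greenFlux q ψ (2 * n)) atTop (𝓝 0)) : x.im = 0 := by
  by_contra hx
  have h_succ : ∀ n, greenFlux q ψ (n + 1) / x.im = greenFlux q ψ n / x.im + ‖ψ (n + 1)‖ ^ 2 :=
    fun n => by rw [hψ.greenFlux_succ hq, add_div, mul_div_cancel_left₀ _ hx]
  have h_mono : Monotone fun n => greenFlux q ψ n / x.im :=
    monotone_int_of_le_succ fun n => by
      rw [h_succ]
      exact le_add_of_nonneg_right (sq_nonneg _)
  have h_bot : Tendsto (fun n => greenFlux q ψ n / x.im) atBot (𝓝 0) := by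
    simpa using (tendsto_greenFlux_atBot hq1 hψb).div_const x.im
  have h_even : Tendsto (fun n : ℕ => (2 * n : ℤ)) atTop atTop :=
    tendsto_natCast_atTop_atTop.const_mul_atTop' two_pos
  have h_top' : Tendsto (fun n => greenFlux q ψ n / x.im) atTop (𝓝 0) :=
    (tendsto_iff_tendsto_subseq_of_monotone h_mono h_even).2 (by
      simpa [Function.comp_def] using h_top.div_const x.im)
  have h_zero : ∀ n, greenFlux q ψ n / x.im = 0 := fun n =>
    le_antisymm (h_mono.ge_of_tendsto h_top' n) (h_mono.le_of_tendsto h_bot n)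
  refine hψ0 (funext fun n => ?_)
  simpa [h_zero, eq_comm] using h_succ (n - 1)

end GreenFlux

section Operator

open scoped ENNReal

variable {q : ℝ} {t : OnePoint ℝ} {x : ℂ}

lemma HasBoundaryValues.im_mul_conj_eq_zero {a b : ℂ} {ψ : ℤ → ℂ}
    (h : HasBoundaryValues (q : ℂ) ψ a b) (hq : (q : ℂ) ≠ 0) (ht : boundaryCond q t ψ) :
    (b * (starRingEnd ℂ) a).im = 0 := by
  cases t using OnePoint.rec with
  | infty => rw [h.boundaryCond_infty_iff.1 ht, map_zero, mul_zero, Complex.zero_im]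
  | coe t =>
    rw [eq_neg_of_add_eq_zero_left ((h.boundaryCond_coe_iff hq t).1 ht), neg_mul, mul_assoc,
      Complex.mul_conj, ← Complex.ofReal_mul, ← Complex.ofReal_neg, Complex.ofReal_im]

theorem im_eq_zero_of_boundaryCond_eigenSeq (hq : (q : ℂ) ≠ 0) (hq1 : ‖(q : ℂ)‖ < 1) (hx : x ≠ 0)
    (ht : boundaryCond q t (eigenSeq q x)) : x.im = 0 := by
  have h := hasBoundaryValues_eigenSeq hq hq1 hx
  refine (isJacobiSolution_eigenSeq hq hq1 hx).im_eq_zero_of_tendsto_greenFlux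
    (Complex.ofReal_ne_zero.1 hq) (by simpa using hq1)
    ((memℓp_eigenSeq hq hq1 hx).of_exponent_ge le_top) (eigenSeq_ne_zero hq hq1 hx) ?_
  simpa only [h.im_mul_conj_eq_zero hq ht] using h.tendsto_greenFlux

lemma mem_pmapEigenspace_jacobiExt (hq : (q : ℂ) ≠ 0) {ψ : (jacobiExt q t).domain} :
    ψ ∈ pmapEigenspace (jacobiExt q t) x ↔ IsJacobiSolution (q : ℂ) x (ψ : ℓ²(ℤ, ℂ)) := by
  rw [pmapEigenspace, LinearMap.mem_ker, LinearMap.sub_apply, sub_eq_zero,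
    ← jacobiExpr_eq_smul_iff hq]
  exact Subtype.ext_iff

lemma memℓp_infty_coeFn (ψ : ℓ²(ℤ, ℂ)) : Memℓp ψ ∞ :=
  (lp.memℓp ψ).of_exponent_ge le_top

lemma coeFn_ne_zero {E : Submodule ℂ ℓ²(ℤ, ℂ)} {ψ : E} (hψ : ψ ≠ 0) :
    ((ψ : ℓ²(ℤ, ℂ)) : ℤ → ℂ) ≠ 0 :=
  fun h => hψ (Subtype.ext (Subtype.ext h))

lemma exists_eigenvector_eq_eigenSeq (hq : (q : ℂ) ≠ 0) (hq1 : ‖(q : ℂ)‖ < 1) (hx : x ≠ 0)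
    (ht : boundaryCond q t (eigenSeq q x)) :
    ∃ v : pmapEigenspace (jacobiExt q t) x, v ≠ 0 ∧
      (((v : (jacobiExt q t).domain) : ℓ²(ℤ, ℂ)) : ℤ → ℂ) = eigenSeq q x := by
  have h_sol := isJacobiSolution_eigenSeq hq hq1 hx
  have h_mem := memℓp_eigenSeq hq hq1 hx
  have h_image : Memℓp (jacobiExpr q (eigenSeq q x)) 2 := by
    rw [(jacobiExpr_eq_smul_iff hq).2 h_sol]
    exact h_mem.const_smul x
  refine ⟨⟨⟨⟨eigenSeq q x, h_mem⟩, ht, h_image⟩, (mem_pmapEigenspace_jacobiExt hq).2 h_sol⟩,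
    fun h => eigenSeq_ne_zero hq hq1 hx ?_, rfl⟩
  exact congrArg (fun v : pmapEigenspace (jacobiExt q t) x => ((v.1.1 : ℓ²(ℤ, ℂ)) : ℤ → ℂ)) h

theorem mem_pointSpectrum_jacobiExt_iff (hq : (q : ℂ) ≠ 0) (hq1 : ‖(q : ℂ)‖ < 1) :
    x ∈ pointSpectrum (jacobiExt q t) ↔ x ≠ 0 ∧ boundaryCond q t (eigenSeq q x) := by
  refine ⟨fun h => ?_, fun ⟨hx, ht⟩ => ?_⟩
  · obtain ⟨ψ, hψ, hψ0⟩ := (Submodule.ne_bot_iff _).1 h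
    rw [mem_pmapEigenspace_jacobiExt hq] at hψ
    have hx : x ≠ 0 := by
      rintro rfl
      exact coeFn_ne_zero hψ0 (hψ.eq_zero_of_eigenvalue_zero hq1 (memℓp_infty_coeFn ψ))
    obtain ⟨c, hc⟩ := hψ.exists_eq_smul_eigenSeq hq hq1 hx (memℓp_infty_coeFn ψ)
    have hc0 : c ≠ 0 := by
      rintro rfl
      exact coeFn_ne_zero hψ0 (by rw [hc, zero_smul])
    let φ : ℓ²(ℤ, ℂ) := ⟨eigenSeq q x, memℓp_eigenSeq hq hq1 hx⟩
    have hφ : c • φ ∈ boundarySpace q t := by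
      rw [← show (ψ : ℓ²(ℤ, ℂ)) = c • φ from Subtype.ext hc]
      exact ψ.2.1
    exact ⟨hx, (Submodule.smul_mem_iff _ hc0).1 hφ⟩
  · obtain ⟨v, hv, -⟩ := exists_eigenvector_eq_eigenSeq hq hq1 hx ht
    exact (Submodule.ne_bot_iff _).2 ⟨v, v.2, fun h => hv (Subtype.ext h)⟩

theorem finrank_pmapEigenspace_jacobiExt (hq : (q : ℂ) ≠ 0) (hq1 : ‖(q : ℂ)‖ < 1)
    (h : x ∈ pointSpectrum (jacobiExt q t)) :
    Module.finrank ℂ (pmapEigenspace (jacobiExt q t) x) = 1 := by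
  obtain ⟨hx, ht⟩ := (mem_pointSpectrum_jacobiExt_iff hq hq1).1 h
  obtain ⟨v, hv0, hv⟩ := exists_eigenvector_eq_eigenSeq hq hq1 hx ht
  refine (finrank_eq_one_iff_of_nonzero' v hv0).2 fun w => ?_
  obtain ⟨c, hc⟩ := ((mem_pmapEigenspace_jacobiExt hq).1 w.2).exists_eq_smul_eigenSeq hq hq1 hx
    (memℓp_infty_coeFn w.1)
  rw [← hv] at hc
  exact ⟨c, Subtype.ext (Subtype.ext (Subtype.ext hc.symm))⟩

end Operator

theorem mainTheorem2_general (q : ℝ) (hq0 : q ≠ 0) (hq1 : |q| < 1) :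
    (∀ t : ℝ, pointSpectrum (jacobiExt q (t : OnePoint ℝ)) =
      {x : ℂ | x ≠ 0 ∧
        x * qTheta ((q : ℂ) ^ 4) ((q : ℂ) ^ 2 * x ^ 2)
          + (t : ℂ) * qTheta ((q : ℂ) ^ 4) (x ^ 2) = 0}) ∧
    (pointSpectrum (jacobiExt q (OnePoint.infty : OnePoint ℝ)) =
      {x : ℂ | x ≠ 0 ∧ qTheta ((q : ℂ) ^ 4) (x ^ 2) = 0}) ∧
    (∀ t : OnePoint ℝ, ∀ x ∈ pointSpectrum (jacobiExt q t),
      x.im = 0 ∧ Module.finrank ℂ (pmapEigenspace (jacobiExt q t) x) = 1) := by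
  have hq : (q : ℂ) ≠ 0 := Complex.ofReal_ne_zero.2 hq0
  have hq1' : ‖(q : ℂ)‖ < 1 := by rwa [Complex.norm_real, Real.norm_eq_abs]
  refine ⟨fun t => Set.ext fun x => ?_, Set.ext fun x => ?_, fun t x h => ?_⟩
  · refine (mem_pointSpectrum_jacobiExt_iff hq hq1').trans (and_congr_right fun hx => ?_)
    rw [(hasBoundaryValues_eigenSeq hq hq1' hx).boundaryCond_coe_iff hq,
      mul_left_comm (t : ℂ), ← mul_add, mul_eq_zero, or_iff_right (boundaryConst_ne_zero hq1')]
  · refine (mem_pointSpectrum_jacobiExt_iff hq hq1').trans (and_congr_right fun hx => ?_)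
    rw [(hasBoundaryValues_eigenSeq hq hq1' hx).boundaryCond_infty_iff, mul_eq_zero,
      or_iff_right (boundaryConst_ne_zero hq1')]
  · obtain ⟨hx, ht⟩ := (mem_pointSpectrum_jacobiExt_iff hq hq1').1 h
    exact ⟨im_eq_zero_of_boundaryCond_eigenSeq hq hq1' hx ht,
      finrank_pmapEigenspace_jacobiExt hq hq1' h⟩

theorem mainTheorem2 (q : ℝ) (hq0 : 0 < q) (hq1 : q < 1) :
    (∀ t : ℝ, pointSpectrum (jacobiExt q (t : OnePoint ℝ)) =
      {x : ℂ | x ≠ 0 ∧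
        x * qTheta ((q : ℂ) ^ 4) ((q : ℂ) ^ 2 * x ^ 2)
          + (t : ℂ) * qTheta ((q : ℂ) ^ 4) (x ^ 2) = 0}) ∧
    (pointSpectrum (jacobiExt q (OnePoint.infty : OnePoint ℝ)) =
      {x : ℂ | x ≠ 0 ∧ qTheta ((q : ℂ) ^ 4) (x ^ 2) = 0}) ∧
    (∀ t : OnePoint ℝ, ∀ x ∈ pointSpectrum (jacobiExt q t),
      x.im = 0 ∧ Module.finrank ℂ (pmapEigenspace (jacobiExt q t) x) = 1) :=
  mainTheorem2_general q hq0.ne' (by rwa [abs_of_pos hq0])
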